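/- **Conventions.** A semi-Markovian graph (SMG) $G$ on a finite set $V$ of observed variables consists of an acyclic set of directed edges and a set of bidirected edges between distinct vertices. A semi-Markovian causal model $M$ over $V$ has finitely many mutually independent unobserved variables $U$ (with arbitrary domains), observed variables $v\in V$ with nonempty countable discrete domains, and for each $v\in V$ a (measurable) function $f_v$ that determines $v$ from a set of observed and a set of unobserved arguments; each $U$ is an argument of at most two of these functions, and the relation "$a$ is an argument of $f_b$" on $V$ is acyclic. $M$ induces $G$ if, for all $a,b\in V$, $a\to b$ in $G$ iff $a$ is an argument of $f_b$, and $a\leftrightarrow b$ in $G$ iff $a\ne b$ and $f_a$, $f_b$ share an unobserved argument. $P$ denotes the distribution of the observed variables in $M$, $P(S)$ its marginal on $S\subseteq V$, and $P_{x}(y)$ the probability of $Y=y$ after replacing, for every $v\in X$, the function $f_v$ by the constant $x_v$. The effect of $X$ on $Y$ is identifiable from $P$ in $G$ if any two models that induce $G$ and have the same, everywhere positive, observed distribution have the same $P_x(y)$ for all values $x,y$. $\mathrm{An}(Y)_G$ is $Y$ together with all its ancestors, and $G[S]$ is the induced subgraph, which retains both the directed and the bidirected edges inside $S$. **Theorem.**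 Let $G$ be an SMG on $V$, let $X,Y\subseteq V$ be disjoint with $G=G[\mathrm{An}(Y)_G]$, let $Z\subseteq V$ satisfy $Z\cap(X\cup Y)=\emptyset$, and let $W\in V\setminus Z$. Suppose that $Z$ is connected to $V\setminus Z$ only through $W$, i.e. every path between a vertex of $Z$ and a vertex of $V\setminus Z$ (ignoring edge directions and using directed and bidirected edges) contains $W$. Then $P_x(y)$ obtained from $P$ in $G$ is equal to $P'_x(y)$ obtained from $P'=P(V\setminus Z)$ in $G[V\setminus Z]$, in the following sense. 1. For every model $M$ that induces $G$, with observed distribution $P$, there is a model $M'$ that induces $G[V\setminus Z]$, whose observed distribution is $P'=P(V\setminus Z)$ and whose effect satisfies $P'_x(y)=P_x(y)$ for all values $x,y$. 2. The effect of $X$ on $Y$ is identifiable from $P$ in $G$ if and only if it is identifiable from $P'$ in $G[V\setminus Z]$. 3. If it is identifiable, then for every model $M$ that induces $G$ and has a positive observed distribution $P$, and every model $M'$ that induces $G[V\setminus Z]$ and has the observed distribution $P'=P(V\setminus Z)$, one has $P_x(y)=P'_x(y)$ for all values $x,y$. -/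

import Mathlib

open Set MeasureTheory
open scoped ENNReal

universe u

/-- A semi-Markovian graph on the vertex set `V` of observed variables: an acyclic directed graph
together with bidirected edges (each standing for an unobserved common parent). -/
@[ext]
structure SMG (V : Type u) where
  /-- `dir a b` is the edge `a → b`. -/
  dir : V → V → Prop
  /-- `bidir a b` is the edge `a ↔ b`. -/
  bidir : V → V → Prop
  bidir_symm : ∀ a b, bidir a b → bidir b a
  bidir_irrefl : ∀ a, ¬ bidir a a
  acyclic : ∀ a, ¬ Relation.TransGen dir a a

namespace SMG

variable {V : Type u}

/-- The set `An(Y)_G`: the members of `Y` and their ancestors in `G`. -/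
def An (G : SMG V) (Y : Set V) : Set V :=
  {a | ∃ y ∈ Y, Relation.ReflTransGen G.dir a y}

/-- The induced subgraph `G[S]`; it keeps all directed and bidirected edges inside `S`. -/
def induce (G : SMG V) (S : Set V) : SMG S where
  dir a b := G.dir a b
  bidir a b := G.bidir a b
  bidir_symm a b h := G.bidir_symm a b h
  bidir_irrefl a h := G.bidir_irrefl a h
  acyclic a h := G.acyclic a (by
    have key : ∀ b : S, Relation.TransGen (fun a b : S => G.dir a b) a b →
        Relation.TransGen G.dir a b := fun b h => by
      induction h with
      | single h => exact Relation.TransGen.single h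
      | tail _ h ih => exact ih.tail h
    exact key a h)

/-- The undirected graph obtained by ignoring the type and orientation of the edges. -/
def skeleton (G : SMG V) : SimpleGraph V where
  Adj a b := G.dir a b ∨ G.dir b a ∨ G.bidir a b
  symm := ⟨fun a b h => by
    rcases h with h | h | h
    · exact Or.inr (Or.inl h)
    · exact Or.inl h
    · exact Or.inr (Or.inr (G.bidir_symm a b h))⟩
  loopless := ⟨fun a h => by
    rcases h with h | h | h
    · exact G.acyclic a (Relation.TransGen.single h)
    · exact G.acyclic a (Relation.TransGen.single h)
    · exact G.bidir_irrefl a h⟩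

/-- `Z` is connected to the remaining vertices only through the vertex `W`, which is itself
outside of `Z`: every path between `Z` and its complement, where the directions of the edges are
ignored and bidirected edges may be used, contains `W`. -/
def ConnectedOnlyThrough (G : SMG V) (Z : Set V) (W : V) : Prop :=
  W ∉ Z ∧ ∀ z ∈ Z, ∀ v ∉ Z, ∀ p : G.skeleton.Walk z v, W ∈ p.support

end SMG

/-- A semi-Markovian causal model with observed variables indexed by `V`, the variable `v` taking
values in `Ω v`. -/
structure SemiMarkovianModel {V : Type u} (Ω : V → Type) where
  /-- the index set of the unobserved variables -/
  U : Type
  [fintypeU : Fintype U]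
  /-- the domains of the unobserved variables -/
  N : U → Type
  [measurableN : ∀ i, MeasurableSpace (N i)]
  /-- the distributions of the unobserved variables -/
  law : ∀ i, Measure (N i)
  [probLaw : ∀ i, IsProbabilityMeasure (law i)]
  /-- the observed variables in terms of which the function of `v` is defined -/
  pa : V → Set V
  /-- the unobserved variables in terms of which the function of `v` is defined -/
  upa : V → Set U
  /-- the function that determines `v` -/
  f : ∀ v, (∀ p : pa v, Ω p) → (∀ i : upa v, N i) → Ω v
  measurable_f : ∀ v (a : ∀ p : pa v, Ω p) (w : Ω v), MeasurableSet {n | f v a n = w}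
  /-- every unobserved variable appears in at most two functions -/
  upa_card : ∀ i, {v | i ∈ upa v}.encard ≤ 2
  acyclic : ∀ v, ¬ Relation.TransGen (fun a b => a ∈ pa b) v v

namespace SemiMarkovianModel

variable {V : Type u} {Ω : V → Type}

attribute [instance] SemiMarkovianModel.fintypeU SemiMarkovianModel.measurableN
  SemiMarkovianModel.probLaw

/-- The semi-Markovian graph induced by the model. -/
def graph (M : SemiMarkovianModel Ω) : SMG V where
  dir a b := a ∈ M.pa b
  bidir a b := a ≠ b ∧ ∃ i, i ∈ M.upa a ∧ i ∈ M.upa b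
  bidir_symm := fun _ _ ⟨h, i, ha, hb⟩ => ⟨h.symm, i, hb, ha⟩
  bidir_irrefl := fun _ h => h.1 rfl
  acyclic := M.acyclic

/-- The joint distribution of the (mutually independent) unobserved variables. -/
noncomputable def noise (M : SemiMarkovianModel Ω) : Measure (∀ i, M.N i) :=
  Measure.pi M.law

theorem wellFounded_pa [Finite V] (M : SemiMarkovianModel Ω) :
    WellFounded (fun a b => a ∈ M.pa b) := by
  have : IsTrans V (Relation.TransGen fun a b => a ∈ M.pa b) :=
    ⟨fun _ _ _ h h' => h.trans h'⟩
  have : Std.Irrefl (Relation.TransGen fun a b => a ∈ M.pa b) := ⟨M.acyclic⟩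
  exact Subrelation.wf (r := Relation.TransGen fun a b => a ∈ M.pa b)
    (fun h => Relation.TransGen.single h) (Finite.wellFounded_of_trans_of_irrefl _)

open Classical in
/-- The values of the observed variables in the sub-model obtained by the intervention `do(x)` on
`X`, when the unobserved variables have the value `n`: the function of each `v ∈ X` is replaced by
the constant `x v`. Only the coordinates of `x` in `X` matter. -/
noncomputable def solution [Finite V] (M : SemiMarkovianModel Ω) (X : Set V) (x : ∀ v, Ω v)
    (n : ∀ i, M.N i) : ∀ v, Ω v :=
  M.wellFounded_pa.fix fun v ih =>
    if v ∈ X then x v else M.f v (fun p => ih p p.2) (fun i => n i)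

open Classical in
theorem solution_eq [Finite V] (M : SemiMarkovianModel Ω) (X : Set V) (x : ∀ v, Ω v)
    (n : ∀ i, M.N i) (v : V) :
    M.solution X x n v =
      if v ∈ X then x v else M.f v (fun p => M.solution X x n p) (fun i => n i) :=
  M.wellFounded_pa.fix_eq _ v

/-- The probability `P_x(y)` that `Y` takes the value `y` under the intervention `do(X = x)`. Only
the coordinates of `x` in `X` and of `y` in `Y` matter. -/
noncomputable def effect [Finite V] (M : SemiMarkovianModel Ω) (X : Set V) (x : ∀ v, Ω v)
    (Y : Set V) (y : ∀ v, Ω v) : ℝ≥0∞ :=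
  M.noise {n | ∀ v ∈ Y, M.solution X x n v = y v}

/-- The observational probability `P(S = s)`, that is, without any intervention. As a function of
`s` it is the (marginal) distribution `P(S)`; the joint distribution is `P(V)`. -/
noncomputable def obs [Finite V] (M : SemiMarkovianModel Ω) (S : Set V) (s : ∀ v, Ω v) : ℝ≥0∞ :=
  M.effect ∅ s S s

end SemiMarkovianModel

/-- The causal effect of `X` on `Y` is identifiable from `P` in `G`: any two causal models that
induce `G` and have the same, positive, joint distribution of the observed variables (with any
countable discrete domains) agree on `P_x(y)` for all values `x` and `y`. -/
def Identifiable {V : Type u} [Finite V] (G : SMG V) (X Y : Set V) : Prop :=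
  ∀ (Ω : V → Type) [∀ v, Countable (Ω v)] [∀ v, Nonempty (Ω v)] (M₁ M₂ : SemiMarkovianModel Ω),
    M₁.graph = G → M₂.graph = G →
    (∀ v, 0 < M₁.obs univ v) → (∀ v, M₁.obs univ v = M₂.obs univ v) →
    ∀ x y, M₁.effect X x Y y = M₂.effect X x Y y

/-!
Substituting the functions of the variables in `Z` into the functions of the others turns a model
`M` into a model over `V \ Z` with the same observed distribution and the same effects of
interventions outside of `Z`. Every edge between `Z` and its complement is incident to `W`, so this
changes only the function of `W`. A vertex `p ∉ Z` with a directed path through `Z` to `W` would be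
`W` itself, on a cycle; hence no parent is added. An unobserved argument of a function in `Z`
becomes an argument of at most the function of `W`, hence no bidirected edge is added either.

Conversely, a model over `V \ Z` extends to one that induces `G`: the variables in `Z` become
independent of everything else with full support, and the missing edges are added as arguments that
the functions ignore. This multiplies the observed distribution by a positive factor that does not
depend on the model. So equal positive distributions stay equal and positive in both directions,
which transfers identifiability.
-/

open Classical in
/-- The extension of a partial dependent function by arbitrary values. -/
noncomputable def extendPi {ι : Type*} {α : ι → Type*} [∀ i, Nonempty (α i)] (s : Set ι)
    (a : ∀ i : s, α i) (i : ι) : α i :=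
  if h : i ∈ s then a ⟨i, h⟩ else Classical.arbitrary _

theorem extendPi_of_mem {ι : Type*} {α : ι → Type*} [∀ i, Nonempty (α i)] {s : Set ι}
    (a : ∀ i : s, α i) {i : ι} (h : i ∈ s) : extendPi s a i = a ⟨i, h⟩ :=
  dif_pos h

theorem measurable_extendPi {ι : Type*} {α : ι → Type*} [∀ i, Nonempty (α i)]
    [∀ i, MeasurableSpace (α i)] (s : Set ι) :
    Measurable (extendPi s : (∀ i : s, α i) → ∀ i, α i) := by
  refine measurable_pi_lambda _ fun i => ?_
  by_cases h : i ∈ s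
  · simpa only [extendPi_of_mem _ h] using measurable_pi_apply _
  · simpa only [extendPi, dif_neg h] using measurable_const

section SumElim

variable {ι κ : Type*} {α : ι → Type u} {β : κ → Type u} [∀ i, MeasurableSpace (α i)]
  [∀ j, MeasurableSpace (β j)]

instance sumElimMeasurableSpace : ∀ i : ι ⊕ κ, MeasurableSpace (Sum.elim α β i)
  | .inl i => inferInstanceAs (MeasurableSpace (α i))
  | .inr j => inferInstanceAs (MeasurableSpace (β j))

/-- The family of measures on `Sum.elim α β` that combines a family on `α` and one on `β`: the laws
of the unobserved variables of a model to which new ones are added. -/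
noncomputable def sumElimMeasure (μ : ∀ i, Measure (α i)) (ν : ∀ j, Measure (β j)) :
    ∀ i : ι ⊕ κ, Measure (Sum.elim α β i)
  | .inl i => μ i
  | .inr j => ν j

variable (μ : ∀ i, Measure (α i)) (ν : ∀ j, Measure (β j))

instance sumElimMeasure.isProbabilityMeasure [∀ i, IsProbabilityMeasure (μ i)]
    [∀ j, IsProbabilityMeasure (ν j)] : ∀ i, IsProbabilityMeasure (sumElimMeasure μ ν i)
  | .inl i => inferInstanceAs (IsProbabilityMeasure (μ i))
  | .inr j => inferInstanceAs (IsProbabilityMeasure (ν j))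

variable [Fintype ι] [Fintype κ] [∀ i, IsProbabilityMeasure (μ i)]
  [∀ j, IsProbabilityMeasure (ν j)]

theorem pi_sumElimMeasure_setOf_inl_mem_and_inr_mem (A : Set (∀ i, α i)) (B : Set (∀ j, β j)) :
    Measure.pi (sumElimMeasure μ ν) {n | (fun i => n (.inl i)) ∈ A ∧ (fun j => n (.inr j)) ∈ B} =
      Measure.pi μ A * Measure.pi ν B :=
  ((measurePreserving_sumPiEquivProdPi (sumElimMeasure μ ν)).measure_preimage_equiv
    (A ×ˢ B)).trans (Measure.prod_prod (μ := Measure.pi μ) (ν := Measure.pi ν) A B)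

theorem pi_sumElimMeasure_setOf_inl_mem (A : Set (∀ i, α i)) :
    Measure.pi (sumElimMeasure μ ν) {n | (fun i => n (.inl i)) ∈ A} = Measure.pi μ A := by
  have h := pi_sumElimMeasure_setOf_inl_mem_and_inr_mem μ ν A univ
  rw [measure_univ, mul_one] at h
  exact (congrArg _ (Set.ext fun n => (and_iff_left (mem_univ _)).symm)).trans h

end SumElim

theorem pi_setOf_forall_equivFin {ι α : Type*} [Finite ι] {β : ι → Type*} [MeasurableSpace α]
    (μ : Measure α) [SigmaFinite μ] (g : ∀ i, α → β i) (y : ∀ i, β i) :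
    Measure.pi (fun _ : Fin (Nat.card ι) => μ) {t | ∀ i, g i (t (Finite.equivFin ι i)) = y i} =
      ∏ᶠ i, μ {t | g i t = y i} := by
  let e := Finite.equivFin ι
  have hrect : {t : Fin (Nat.card ι) → α | ∀ i, g i (t (e i)) = y i} =
      univ.pi fun j => {t | g (e.symm j) t = y (e.symm j)} := by
    ext t
    simp only [mem_ofPred_eq, mem_univ_pi]
    exact e.symm.forall_congr_right.symm.trans (by simp only [Equiv.apply_symm_apply])
  rw [hrect, Measure.pi_pi, ← finprod_eq_prod_of_fintype]
  exact finprod_comp_equiv e.symm (f := fun i => μ {t | g i t = y i})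

theorem exists_pmf_forall_pos (α : Type*) [Countable α] [Nonempty α] :
    ∃ p : PMF α, ∀ a, 0 < p a := by
  obtain ⟨w, hw, hsum⟩ := ENNReal.exists_pos_sum_of_countable' one_ne_zero α
  have hw₀ : ∑' a, w a ≠ 0 := fun h =>
    (hw (Classical.arbitrary α)).ne' (ENNReal.tsum_eq_zero.mp h _)
  refine ⟨PMF.normalize w hw₀ (hsum.trans ENNReal.one_lt_top).ne, fun a => ?_⟩
  rw [PMF.apply_pos_iff, PMF.mem_support_normalize_iff]
  exact (hw a).ne'

theorem transGen_subtype_of_transGen {α : Type*} {s : Set α} {r : s → s → Prop} {a b : α}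
    (h : Relation.TransGen (fun a b => ∃ (ha : a ∈ s) (hb : b ∈ s), r ⟨a, ha⟩ ⟨b, hb⟩) a b) :
    ∃ (ha : a ∈ s) (hb : b ∈ s), Relation.TransGen r ⟨a, ha⟩ ⟨b, hb⟩ := by
  induction h with
  | single h => exact h.imp fun _ h => h.imp fun _ h => .single h
  | tail _ h ih =>
    obtain ⟨ha, _, ih⟩ := ih
    obtain ⟨_, hc, h⟩ := h
    exact ⟨ha, hc, ih.tail h⟩

namespace SMG

variable {V : Type u} {G : SMG V} {S Z : Set V} {W : V} {a p v z : V}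

/-- `G ≤ H` means that every edge of `G` is an edge of `H` of the same type. -/
instance : LE (SMG V) where
  le G H := (∀ a b, G.dir a b → H.dir a b) ∧ ∀ a b, G.bidir a b → H.bidir a b

/-- The vertices with a directed path to `v` that lies outside of `S` except for its last vertex
`v`: the functions that have to be composed to determine `v` from variables in `S` when the
variables outside of `S` are no longer observed. -/
def latentAn (G : SMG V) (S : Set V) (v : V) : Set V :=
  {a | Relation.ReflTransGen (fun a b => a ∉ S ∧ G.dir a b) a v}

theorem self_mem_latentAn : v ∈ G.latentAn S v :=
  Relation.ReflTransGen.refl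

theorem mem_latentAn_of_dir (hp : p ∉ S) (hpa : G.dir p a) (ha : a ∈ G.latentAn S v) :
    p ∈ G.latentAn S v :=
  Relation.ReflTransGen.head ⟨hp, hpa⟩ ha

theorem eq_of_mem_latentAn (ha : a ∈ G.latentAn S v) (haS : a ∈ S) : a = v :=
  (Relation.ReflTransGen.cases_head ha).resolve_right fun ⟨_, h, _⟩ => h.1 haS

theorem transGen_of_dir_latentAn (hpa : G.dir p a) (ha : a ∈ G.latentAn S v) :
    Relation.TransGen G.dir p v :=
  Relation.TransGen.head' hpa (Relation.ReflTransGen.mono (fun _ _ h => h.2) _ _ ha)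

namespace ConnectedOnlyThrough

theorem eq_of_adj (hW : G.ConnectedOnlyThrough Z W) (hz : z ∈ Z) (hv : v ∉ Z)
    (h : G.skeleton.Adj z v) : v = W := by
  have hmem : W ∈ h.toWalk.support := hW.2 z hz v hv h.toWalk
  simp only [SimpleGraph.Walk.support_cons, SimpleGraph.Walk.support_nil, List.mem_cons,
    List.not_mem_nil, or_false] at hmem
  exact (hmem.resolve_left fun h => hW.1 (h ▸ hz)).symm

theorem eq_of_mem_latentAn (hW : G.ConnectedOnlyThrough Z W) (hz : z ∈ Z) (hv : v ∉ Z)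
    (h : z ∈ G.latentAn Zᶜ v) : v = W := by
  obtain rfl | ⟨c, -, hc, hcv⟩ := Relation.ReflTransGen.cases_tail h
  · exact absurd hz hv
  · exact hW.eq_of_adj (notMem_compl_iff.mp hc) hv (Or.inl hcv)

/-- A directed path that enters `Z` and leaves it again would be a cycle through `W`. -/
theorem dir_of_dir_latentAn (hW : G.ConnectedOnlyThrough Z W) (hp : p ∉ Z) (hv : v ∉ Z)
    (hpa : G.dir p a) (ha : a ∈ G.latentAn Zᶜ v) : G.dir p v := by
  by_cases haZ : a ∈ Z
  · obtain rfl := hW.eq_of_adj haZ hp (Or.inr (Or.inl hpa))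
    obtain rfl := hW.eq_of_mem_latentAn haZ hv ha
    exact absurd (transGen_of_dir_latentAn hpa ha) (G.acyclic v)
  · exact SMG.eq_of_mem_latentAn ha haZ ▸ hpa

end ConnectedOnlyThrough

end SMG

namespace SemiMarkovianModel

variable {V : Type u} {Ω : V → Type}

section Solution

variable [Finite V] (M : SemiMarkovianModel Ω) {X X' : Set V} {x x' : ∀ v, Ω v}
  {n n' : ∀ i, M.N i}

theorem solution_of_mem {v : V} (hv : v ∈ X) : M.solution X x n v = x v :=
  (M.solution_eq X x n v).trans (if_pos hv)

theorem solution_of_notMem {v : V} (hv : v ∉ X) :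
    M.solution X x n v = M.f v (fun p => M.solution X x n p) (fun i => n i) :=
  (M.solution_eq X x n v).trans (if_neg hv)

theorem eq_solution {s : ∀ v, Ω v} (hX : ∀ v ∈ X, s v = x v)
    (hf : ∀ v ∉ X, s v = M.f v (fun p => s p) (fun i => n i)) : s = M.solution X x n := by
  funext v
  induction v using M.wellFounded_pa.induction with
  | h v ih =>
    by_cases hv : v ∈ X
    · rw [hX v hv, M.solution_of_mem hv]
    · rw [hf v hv, M.solution_of_notMem hv, funext fun p : M.pa v => ih p p.2]

theorem solution_congr_of_boundary {A : Set V} (hX : Disjoint A X) (hX' : Disjoint A X')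
    (hn : ∀ v ∈ A, ∀ i ∈ M.upa v, n i = n' i)
    (hpa : ∀ v ∈ A, ∀ p ∈ M.pa v, p ∉ A → M.solution X x n p = M.solution X' x' n' p) :
    ∀ v ∈ A, M.solution X x n v = M.solution X' x' n' v := by
  intro v
  induction v using M.wellFounded_pa.induction with
  | h v ih =>
    intro hv
    have hparents : ∀ p ∈ M.pa v, M.solution X x n p = M.solution X' x' n' p := fun p hp =>
      (em (p ∈ A)).elim (ih p hp) (hpa v hv p hp)
    rw [M.solution_of_notMem (hX.notMem_of_mem_left hv),
      M.solution_of_notMem (hX'.notMem_of_mem_left hv),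
      funext fun p : M.pa v => hparents p p.2, funext fun i : M.upa v => hn v hv i i.2]

theorem solution_empty_congr (x x' : ∀ v, Ω v) : M.solution ∅ x n = M.solution ∅ x' n :=
  M.eq_solution (fun _ h => h.elim) fun _ hv => M.solution_of_notMem hv

theorem measurableSet_solution_eq [∀ v, Countable (Ω v)] (X : Set V) (x : ∀ v, Ω v) (v : V)
    (w : Ω v) : MeasurableSet {n | M.solution X x n v = w} := by
  induction v using M.wellFounded_pa.induction with
  | h v ih =>
    by_cases hv : v ∈ X
    · simp only [M.solution_of_mem hv, MeasurableSet.const]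
    · have hunion : {n | M.solution X x n v = w} = ⋃ a : ∀ p : M.pa v, Ω p,
          (⋂ p : M.pa v, {n | M.solution X x n p = a p}) ∩
            (fun (n : ∀ i, M.N i) (i : M.upa v) => n i) ⁻¹' {n | M.f v a n = w} := by
        ext n
        simp only [M.solution_of_notMem hv, mem_ofPred_eq, mem_iUnion, mem_inter_iff,
          mem_iInter, mem_preimage]
        exact ⟨fun h => ⟨_, fun _ => rfl, h⟩, fun ⟨a, ha, h⟩ => by rwa [funext ha]⟩
      rw [hunion]
      exact .iUnion fun a => .inter (.iInter fun p => ih p p.2 _)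
        (measurable_pi_lambda _ (fun i => measurable_pi_apply _) (M.measurable_f v a w))

end Solution

section Obs

variable [Finite V] (M : SemiMarkovianModel Ω)

theorem obs_eq_noise_preimage (x : ∀ v, Ω v) (S : Set V) (s : ∀ v, Ω v) :
    M.obs S s = M.noise ((M.solution ∅ x) ⁻¹' {t | ∀ v ∈ S, t v = s v}) := by
  simp only [obs, effect, M.solution_empty_congr s x, preimage_ofPred_eq]

theorem obs_univ_le (S : Set V) (s : ∀ v, Ω v) : M.obs univ s ≤ M.obs S s :=
  measure_mono fun _ hn v _ => hn v (mem_univ v)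

theorem obs_eq_tsum [∀ v, Countable (Ω v)] (S : Set V) (s : ∀ v, Ω v) :
    M.obs S s = ∑' t : {t : ∀ v, Ω v | ∀ v ∈ S, t v = s v}, M.obs univ t := by
  have hsingleton : ∀ t : ∀ v, Ω v, {t' | ∀ v ∈ univ, t' v = t v} = {t} := fun t => by
    ext
    simp [funext_iff]
  have hmeas : ∀ t, MeasurableSet (M.solution ∅ s ⁻¹' {t}) := fun t => by
    simp only [← hsingleton, mem_univ, forall_true_left, ofPred_forall, preimage_iInter]
    exact .iInter fun v => M.measurableSet_solution_eq ∅ s v _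
  simp only [M.obs_eq_noise_preimage s, hsingleton]
  exact (tsum_measure_preimage_singleton (to_countable _) fun t _ => hmeas t).symm

theorem obs_congr [∀ v, Countable (Ω v)] {M₁ M₂ : SemiMarkovianModel Ω}
    (h : ∀ v, M₁.obs univ v = M₂.obs univ v) (S : Set V) (s : ∀ v, Ω v) :
    M₁.obs S s = M₂.obs S s := by
  simp only [obs_eq_tsum _ S, h]

end Obs

section Project

instance (M : SemiMarkovianModel Ω) (i : M.U) : Nonempty (M.N i) :=
  nonempty_of_isProbabilityMeasure (M.law i)

/-- The unobserved arguments of the composition of the functions of `M.graph.latentAn S v`. -/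
def latentUpa (M : SemiMarkovianModel Ω) (S : Set V) (v : V) : Set M.U :=
  {i | ∃ a ∈ M.graph.latentAn S v, i ∈ M.upa a}

variable [Finite V] [∀ v, Countable (Ω v)] [∀ v, Nonempty (Ω v)] {M : SemiMarkovianModel Ω}
  {S : Set V}

variable (M S) in
/-- The latent projection of a model to `S`: a variable `v ∈ S` is determined by substituting the
functions of the variables outside of `S` into its own, that is, by its response in `M` when the
other variables in `S` are held fixed. In general an unobserved variable can end up in more than
two of these functions; `hcard` excludes this. -/
noncomputable def project (hcard : ∀ i, {v : S | i ∈ M.latentUpa S v}.encard ≤ 2) :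
    SemiMarkovianModel (fun v : S => Ω v) where
  U := M.U
  N := M.N
  law := M.law
  pa v := {p | ∃ a ∈ M.graph.latentAn S v, p.1 ∈ M.pa a}
  upa v := M.latentUpa S v
  f v a n := M.solution (S \ {v.1}) (extendPi S (extendPi _ a)) (extendPi _ n) v
  measurable_f v _ w := measurable_extendPi _ (M.measurableSet_solution_eq _ _ v.1 w)
  upa_card := hcard
  acyclic v h := M.acyclic v (Relation.TransGen.lift' Subtype.val
    (fun _ _ ⟨_, ha, hpa⟩ => SMG.transGen_of_dir_latentAn hpa ha) v v h)

theorem project_solution {hcard : ∀ i, {v : S | i ∈ M.latentUpa S v}.encard ≤ 2} {X : Set V}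
    (hX : X ⊆ S) (x : ∀ v, Ω v) (n : ∀ i, M.N i) (v : S) :
    (M.project S hcard).solution (Subtype.val ⁻¹' X) (fun v => x v) n v = M.solution X x n v := by
  refine congrFun (((M.project S hcard).eq_solution (s := fun v => M.solution X x n v)
    (fun v hv => M.solution_of_mem hv) fun v hv => ?_).symm) v
  have hAS : ∀ a ∈ M.graph.latentAn S v, a ∈ S → a = v := fun _ => SMG.eq_of_mem_latentAn
  refine M.solution_congr_of_boundary (A := M.graph.latentAn S v) ?_ ?_ ?_ ?_ v
    SMG.self_mem_latentAn
  · exact Set.disjoint_left.mpr fun a ha haX => hv (mem_preimage.mpr (hAS a ha (hX haX) ▸ haX))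
  · exact Set.disjoint_left.mpr fun a ha haS => haS.2 (hAS a ha haS.1)
  · exact fun a ha i hi => (extendPi_of_mem (s := M.latentUpa S v) (fun i => n i) ⟨a, ha, hi⟩).symm
  · intro a ha p hp hpA
    have hpS : p ∈ S := by_contra fun h => hpA (SMG.mem_latentAn_of_dir h hp ha)
    rw [M.solution_of_mem (X := S \ {v.1}) ⟨hpS, fun h => hpA (h ▸ SMG.self_mem_latentAn)⟩,
      extendPi_of_mem _ hpS]
    exact (extendPi_of_mem (α := fun v : S => Ω v) (i := ⟨p, hpS⟩)
      (s := {p : S | ∃ a ∈ M.graph.latentAn S v, p.1 ∈ M.pa a})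
      (fun p => M.solution X x n p) ⟨a, ha, hp⟩).symm

theorem project_effect {hcard : ∀ i, {v : S | i ∈ M.latentUpa S v}.encard ≤ 2} {X Y : Set V}
    (hX : X ⊆ S) (hY : Y ⊆ S) (x y : ∀ v, Ω v) :
    (M.project S hcard).effect (Subtype.val ⁻¹' X) (fun v => x v) (Subtype.val ⁻¹' Y)
      (fun v => y v) = M.effect X x Y y := by
  refine congrArg M.noise (Set.ext fun n => ?_)
  have hsol := project_solution (hcard := hcard) hX x n
  exact ⟨fun h v hv => (hsol ⟨v, hY hv⟩).symm.trans (h ⟨v, hY hv⟩ hv),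
    fun h v hv => (hsol v).trans (h v hv)⟩

theorem project_obs {hcard : ∀ i, {v : S | i ∈ M.latentUpa S v}.encard ≤ 2} (v : ∀ v, Ω v) :
    (M.project S hcard).obs univ (fun i => v i) = M.obs S v := by
  simpa only [obs, preimage_empty, Subtype.coe_preimage_self] using
    project_effect (hcard := hcard) (empty_subset S) Subset.rfl v v

end Project

section ConnectedOnlyThrough

variable {M : SemiMarkovianModel Ω} {Z : Set V} {W : V}

theorem eq_of_mem_latentUpa (hW : M.graph.ConnectedOnlyThrough Z W) {v z : V} (hv : v ∉ Z)
    (hz : z ∈ Z) {i : M.U} (hiz : i ∈ M.upa z) (hi : i ∈ M.latentUpa Zᶜ v) : v = W := by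
  obtain ⟨a, ha, hia⟩ := hi
  by_cases haZ : a ∈ Z
  · exact hW.eq_of_mem_latentAn haZ hv ha
  · obtain rfl := SMG.eq_of_mem_latentAn ha haZ
    exact hW.eq_of_adj hz hv (Or.inr (Or.inr ⟨fun h => hv (h ▸ hz), i, hiz, hia⟩))

theorem mem_upa_of_mem_latentUpa {v : V} {i : M.U} (hZ : ∀ z ∈ Z, i ∉ M.upa z)
    (hi : i ∈ M.latentUpa Zᶜ v) : i ∈ M.upa v := by
  obtain ⟨a, ha, hia⟩ := hi
  exact SMG.eq_of_mem_latentAn ha (fun haZ => hZ a haZ hia) ▸ hia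

theorem encard_setOf_mem_latentUpa_le (hW : M.graph.ConnectedOnlyThrough Z W) (i : M.U) :
    {v : ↥Zᶜ | i ∈ M.latentUpa Zᶜ v}.encard ≤ 2 := by
  by_cases hi : ∃ z ∈ Z, i ∈ M.upa z
  · obtain ⟨z, hz, hiz⟩ := hi
    have hsub : {v : ↥Zᶜ | i ∈ M.latentUpa Zᶜ v}.Subsingleton := fun v hv v' hv' =>
      Subtype.ext ((eq_of_mem_latentUpa hW v.2 hz hiz hv).trans
        (eq_of_mem_latentUpa hW v'.2 hz hiz hv').symm)
    exact (encard_le_one_iff_subsingleton.mpr hsub).trans one_le_two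
  · push Not at hi
    rw [← Subtype.val_injective.encard_image]
    refine (encard_le_encard ?_).trans (M.upa_card i)
    rintro _ ⟨v, hv, rfl⟩
    exact mem_upa_of_mem_latentUpa hi hv

theorem project_graph [Finite V] [∀ v, Countable (Ω v)] [∀ v, Nonempty (Ω v)]
    (hW : M.graph.ConnectedOnlyThrough Z W) :
    (M.project Zᶜ (encard_setOf_mem_latentUpa_le hW)).graph = M.graph.induce Zᶜ := by
  ext a b
  · exact ⟨fun ⟨_, hc, hac⟩ => hW.dir_of_dir_latentAn a.2 b.2 hac hc,
      fun h => ⟨b, SMG.self_mem_latentAn, h⟩⟩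
  · constructor
    · rintro ⟨hab, i, hia, hib⟩
      have hi : ∀ z ∈ Z, i ∉ M.upa z := fun z hz hiz => hab <| Subtype.ext <|
        (eq_of_mem_latentUpa hW a.2 hz hiz hia).trans (eq_of_mem_latentUpa hW b.2 hz hiz hib).symm
      exact ⟨Subtype.coe_injective.ne hab, i, mem_upa_of_mem_latentUpa hi hia,
        mem_upa_of_mem_latentUpa hi hib⟩
    · rintro ⟨hab, i, hia, hib⟩
      exact ⟨ne_of_apply_ne _ hab, i, ⟨a, SMG.self_mem_latentAn, hia⟩,
        ⟨b, SMG.self_mem_latentAn, hib⟩⟩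

end ConnectedOnlyThrough

section AddEdges

variable (M : SemiMarkovianModel Ω) {G : SMG V} (hG : M.graph ≤ G)

/-- The unobserved arguments of `v` in the model `addEdges`: those in `M`, and the one-point
variables attached to the bidirected edges of `G` at `v`. -/
def addEdgesUpa [Finite V] (G : SMG V) (v : V) :
    Set (M.U ⊕ Fin (Nat.card {e : V × V // G.bidir e.1 e.2})) :=
  Sum.elim (M.upa v) fun j =>
    v ∈ ({((Finite.equivFin _).symm j).1.1, ((Finite.equivFin _).symm j).1.2} : Set V)

/-- The model in which the functions of `M` receive the additional arguments prescribed by the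
edges of `G`, and ignore them. Every bidirected edge of `G` contributes a one-point unobserved
variable; these are indexed by some `Fin k`, since the index set of the unobserved variables has
to be in `Type`. -/
noncomputable def addEdges [Finite V] : SemiMarkovianModel Ω where
  U := M.U ⊕ Fin (Nat.card {e : V × V // G.bidir e.1 e.2})
  N := Sum.elim M.N fun _ => Unit
  law := sumElimMeasure M.law fun _ => Measure.dirac ()
  pa v := {p | G.dir p v}
  upa := M.addEdgesUpa G
  f v a n := M.f v (fun p => a ⟨p, hG.1 p v p.2⟩) (fun i => n ⟨.inl i, i.2⟩)
  measurable_f v a w :=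
    measurable_pi_lambda
      (fun (n : ∀ i : M.addEdgesUpa G v, Sum.elim M.N (fun _ => Unit) i.1) (i : M.upa v) =>
        (n ⟨.inl i, i.2⟩ : M.N i))
      (fun i => measurable_pi_apply (⟨.inl i, i.2⟩ : M.addEdgesUpa G v)) (M.measurable_f v _ w)
  upa_card
    | .inl i => M.upa_card i
    | .inr _ => (encard_insert_le _ _).trans_eq (by rw [encard_singleton, one_add_one_eq_two])
  acyclic := G.acyclic

variable [Finite V] {M}

theorem addEdges_graph : (M.addEdges hG).graph = G := by
  ext a b
  · rfl
  · constructor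
    · rintro ⟨hab, i | j, ha, hb⟩
      · exact hG.2 a b ⟨hab, i, ha, hb⟩
      · have hj := ((Finite.equivFin {e : V × V // G.bidir e.1 e.2}).symm j).2
        rcases ha with rfl | rfl <;> rcases hb with rfl | rfl
        · exact absurd rfl hab
        · exact hj
        · exact G.bidir_symm _ _ hj
        · exact absurd rfl hab
    · intro h
      let e : {e : V × V // G.bidir e.1 e.2} := ⟨(a, b), h⟩
      have he : (Finite.equivFin _).symm (Finite.equivFin _ e) = e := Equiv.symm_apply_apply _ e
      refine ⟨fun hab => G.bidir_irrefl a (hab ▸ h), .inr (Finite.equivFin _ e), ?_, ?_⟩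
      · exact Or.inl (congrArg (fun e => e.1.1) he).symm
      · exact Or.inr (congrArg (fun e : {e : V × V // G.bidir e.1 e.2} => e.1.2) he).symm

theorem addEdges_solution (X : Set V) (x : ∀ v, Ω v) (n : ∀ i, (M.addEdges hG).N i) :
    (M.addEdges hG).solution X x n = M.solution X x fun i => n (.inl i) :=
  M.eq_solution (fun _ hv => (M.addEdges hG).solution_of_mem hv)
    fun _ hv => (M.addEdges hG).solution_of_notMem hv

theorem addEdges_effect (X Y : Set V) (x y : ∀ v, Ω v) :
    (M.addEdges hG).effect X x Y y = M.effect X x Y y := by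
  simp only [effect, addEdges_solution]
  exact pi_sumElimMeasure_setOf_inl_mem M.law _ {n | ∀ v ∈ Y, M.solution X x n v = y v}

end AddEdges

section AdjoinIsolated

variable {S : Set V} (M : SemiMarkovianModel (fun v : S => Ω v)) {T : Type} [MeasurableSpace T]
  (ρ : Measure T) [IsProbabilityMeasure ρ] {g : ∀ v : ↥Sᶜ, T → Ω v}
  (hg : ∀ v w, MeasurableSet {t | g v t = w})

/-- The unobserved arguments of `v` in the model `adjoinIsolated`: those in `M` if `v ∈ S`, and a
private one if `v ∉ S`. -/
def adjoinIsolatedUpa [Finite V] (v : V) : Set (M.U ⊕ Fin (Nat.card ↥Sᶜ)) :=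
  Sum.elim (fun i => ∃ hv : v ∈ S, i ∈ M.upa ⟨v, hv⟩) fun j => v = (Finite.equivFin ↥Sᶜ).symm j

theorem inr_equivFin_mem_adjoinIsolatedUpa [Finite V] (v : ↥Sᶜ) :
    .inr (Finite.equivFin ↥Sᶜ v) ∈ M.adjoinIsolatedUpa v :=
  (congrArg Subtype.val (Equiv.symm_apply_apply _ v)).symm

open Classical in
/-- The model on `V` in which the variables in `S` are determined as in `M`, and every `v ∉ S` is
`g v` of a private unobserved variable with distribution `ρ`. -/
noncomputable def adjoinIsolated [Finite V] : SemiMarkovianModel Ω where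
  U := M.U ⊕ Fin (Nat.card ↥Sᶜ)
  N := Sum.elim M.N fun _ => T
  law := sumElimMeasure M.law fun _ => ρ
  pa v := {p | ∃ (hp : p ∈ S) (hv : v ∈ S), ⟨p, hp⟩ ∈ M.pa ⟨v, hv⟩}
  upa := M.adjoinIsolatedUpa
  f v a n :=
    if hv : v ∈ S then M.f ⟨v, hv⟩ (fun p => a ⟨p, p.1.2, hv, p.2⟩) (fun i => n ⟨.inl i, hv, i.2⟩)
    else g ⟨v, hv⟩ (n ⟨_, M.inr_equivFin_mem_adjoinIsolatedUpa ⟨v, hv⟩⟩)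
  measurable_f v a w := by
    by_cases hv : v ∈ S
    · simp only [dif_pos hv]
      exact measurable_pi_lambda
        (fun (n : ∀ i : M.adjoinIsolatedUpa v, Sum.elim M.N (fun _ => T) i.1)
          (i : M.upa ⟨v, hv⟩) => (n ⟨.inl i, hv, i.2⟩ : M.N i))
        (fun i => measurable_pi_apply (⟨.inl i, hv, i.2⟩ : M.adjoinIsolatedUpa v))
        (M.measurable_f ⟨v, hv⟩ _ w)
    · simp only [dif_neg hv]
      let i : M.adjoinIsolatedUpa v := ⟨_, M.inr_equivFin_mem_adjoinIsolatedUpa ⟨v, hv⟩⟩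
      exact (measurable_pi_apply i : Measurable
        fun n : ∀ i : M.adjoinIsolatedUpa v, Sum.elim M.N (fun _ => T) i.1 => (n i : T))
        (hg ⟨v, hv⟩ w)
  upa_card
    | .inl i => by
      have hsub : {v | ∃ hv : v ∈ S, i ∈ M.upa ⟨v, hv⟩} ⊆ Subtype.val '' {v | i ∈ M.upa v} :=
        fun v ⟨hv, hi⟩ => ⟨⟨v, hv⟩, hi, rfl⟩
      exact (encard_le_encard hsub).trans ((encard_image_le _ _).trans (M.upa_card i))
    | .inr j => (encard_singleton _).trans_le one_le_two
  acyclic v h := by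
    obtain ⟨hv, _, h⟩ := transGen_subtype_of_transGen (r := fun a b => a ∈ M.pa b) h
    exact M.acyclic _ h

variable [Finite V] {M ρ hg}

theorem adjoinIsolated_graph_le {G : SMG V} (hM : M.graph = G.induce S) :
    (M.adjoinIsolated ρ hg).graph ≤ G := by
  constructor
  · rintro a b ⟨ha, hb, h⟩
    exact (congrArg (fun H => H.dir ⟨a, ha⟩ ⟨b, hb⟩) hM).mp h
  · rintro a b ⟨hab, i | j, ha, hb⟩
    · obtain ⟨ha, hia⟩ := ha
      obtain ⟨hb, hib⟩ := hb
      exact (congrArg (fun H => H.bidir ⟨a, ha⟩ ⟨b, hb⟩) hM).mp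
        ⟨fun h => hab (congrArg Subtype.val h), i, hia, hib⟩
    · exact absurd (ha.trans hb.symm) hab

theorem adjoinIsolated_solution (X : Set V) (x : ∀ v, Ω v)
    (n : ∀ i, (M.adjoinIsolated ρ hg).N i) (v : S) :
    (M.adjoinIsolated ρ hg).solution X x n v =
      M.solution (Subtype.val ⁻¹' X) (fun v => x v) (fun i => n (.inl i)) v :=
  congrFun (M.eq_solution (n := fun i => n (.inl i))
    (s := fun v => (M.adjoinIsolated ρ hg).solution X x n v)
    (fun _ hv => (M.adjoinIsolated ρ hg).solution_of_mem hv)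
    fun v hv => ((M.adjoinIsolated ρ hg).solution_of_notMem hv).trans (dif_pos v.2)) v

theorem adjoinIsolated_solution_compl {X : Set V} (x : ∀ v, Ω v)
    (n : ∀ i, (M.adjoinIsolated ρ hg).N i) {v : ↥Sᶜ} (hv : v.1 ∉ X) :
    (M.adjoinIsolated ρ hg).solution X x n v = g v (n (.inr (Finite.equivFin ↥Sᶜ v))) :=
  ((M.adjoinIsolated ρ hg).solution_of_notMem hv).trans (dif_neg v.2)

theorem adjoinIsolated_effect (X : Set V) {Y : Set V} (hY : Y ⊆ S) (x y : ∀ v, Ω v) :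
    (M.adjoinIsolated ρ hg).effect X x Y y =
      M.effect (Subtype.val ⁻¹' X) (fun v => x v) (Subtype.val ⁻¹' Y) (fun v => y v) := by
  refine Eq.trans (congrArg (M.adjoinIsolated ρ hg).noise (Set.ext fun n => ?_))
    (pi_sumElimMeasure_setOf_inl_mem M.law _
      {n | ∀ v ∈ Subtype.val ⁻¹' Y, M.solution (Subtype.val ⁻¹' X) (fun v => x v) n v = y v})
  have hsol := adjoinIsolated_solution X x n
  exact ⟨fun h v hv => (hsol v).symm.trans (h v hv),
    fun h v hv => (hsol ⟨v, hY hv⟩).trans (h ⟨v, hY hv⟩ hv)⟩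

theorem adjoinIsolated_obs (y : ∀ v, Ω v) :
    (M.adjoinIsolated ρ hg).obs univ y =
      M.obs univ (fun v => y v) * ∏ᶠ v : ↥Sᶜ, ρ {t | g v t = y v} := by
  rw [← pi_setOf_forall_equivFin ρ g fun v : ↥Sᶜ => y v]
  refine Eq.trans (congrArg (M.adjoinIsolated ρ hg).noise (Set.ext fun n => ?_))
    (pi_sumElimMeasure_setOf_inl_mem_and_inr_mem M.law _
      {n | ∀ v ∈ univ, M.solution ∅ (fun v => y v) n v = y v} _)
  have hS := adjoinIsolated_solution ∅ y n
  have hSc := fun v => adjoinIsolated_solution_compl y n (v := v) (notMem_empty v.1)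
  constructor
  · exact fun h => ⟨fun v _ => (hS v).symm.trans (h v (mem_univ _)),
      fun v => (hSc v).symm.trans (h v (mem_univ _))⟩
  · intro h v _
    by_cases hv : v ∈ S
    · exact (hS ⟨v, hv⟩).trans (h.1 ⟨v, hv⟩ (mem_univ _))
    · exact (hSc ⟨v, hv⟩).trans (h.2 ⟨v, hv⟩)

end AdjoinIsolated

section Existence

variable [Finite V] {G : SMG V} {X Y Z : Set V} {W : V} [∀ v, Countable (Ω v)]
  [∀ v, Nonempty (Ω v)]

theorem exists_projection (hZ : Disjoint Z (X ∪ Y)) (hW : G.ConnectedOnlyThrough Z W)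
    (M : SemiMarkovianModel Ω) (hM : M.graph = G) :
    ∃ M' : SemiMarkovianModel (fun v : ↥Zᶜ => Ω v),
      M'.graph = G.induce Zᶜ ∧
      (∀ v : (∀ i, Ω i), M'.obs univ (fun i => v i) = M.obs Zᶜ v) ∧
      ∀ x y : (∀ i, Ω i),
        M.effect X x Y y =
          M'.effect (Subtype.val ⁻¹' X) (fun i => x i) (Subtype.val ⁻¹' Y) (fun i => y i) := by
  subst hM
  obtain ⟨hX, hY⟩ := disjoint_union_right.mp hZ
  exact ⟨M.project Zᶜ _, project_graph hW, project_obs, fun x y =>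
    (project_effect (subset_compl_iff_disjoint_left.mpr hX)
      (subset_compl_iff_disjoint_left.mpr hY) x y).symm⟩

variable (Ω G) in
/-- Since the factor `c` is positive and the same for all `M`, models with equal positive observed
distributions are extended to such models. -/
theorem exists_extension (S : Set V) :
    ∃ c : (∀ v, Ω v) → ℝ≥0∞, (∀ y, c y ≠ 0) ∧
      ∀ M : SemiMarkovianModel (fun v : S => Ω v), M.graph = G.induce S →
        ∃ M' : SemiMarkovianModel Ω,
          M'.graph = G ∧
          (∀ y, M'.obs univ y = M.obs univ (fun v => y v) * c y) ∧
          ∀ X Y, Y ⊆ S → ∀ x y,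
            M'.effect X x Y y =
              M.effect (Subtype.val ⁻¹' X) (fun v => x v) (Subtype.val ⁻¹' Y) (fun v => y v) := by
  obtain ⟨p, hp⟩ := exists_pmf_forall_pos ℕ
  choose g hg using fun v : ↥Sᶜ => exists_surjective_nat (Ω v)
  have hmeas : ∀ v w, MeasurableSet {t | g v t = w} := fun v w => .of_discrete
  refine ⟨fun y => ∏ᶠ v : ↥Sᶜ, p.toMeasure {t | g v t = y v}, fun y => ?_, fun M hM => ?_⟩
  · refine finprod_ne_zero fun v => ?_
    obtain ⟨t, ht⟩ := hg v (y v)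
    refine ((hp t).trans_le ?_).ne'
    rw [← p.toMeasure_apply_singleton t (.singleton t)]
    exact measure_mono (singleton_subset_iff.mpr ht)
  · have hG : (M.adjoinIsolated p.toMeasure hmeas).graph ≤ G := adjoinIsolated_graph_le hM
    exact ⟨(M.adjoinIsolated p.toMeasure hmeas).addEdges hG, addEdges_graph hG,
      fun y => (addEdges_effect hG ∅ univ y y).trans (adjoinIsolated_obs y),
      fun X Y hY x y => (addEdges_effect hG X Y x y).trans (adjoinIsolated_effect X hY x y)⟩

end Existence

end SemiMarkovianModel

open SemiMarkovianModel

namespace Identifiable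

variable {V : Type u} [Finite V] {G : SMG V} {S X Y Z : Set V} {W : V}

theorem induce (hY : Y ⊆ S) (hG : Identifiable G X Y) :
    Identifiable (G.induce S) (Subtype.val ⁻¹' X) (Subtype.val ⁻¹' Y) := by
  intro Ω' _ _ M₁ M₂ h₁ h₂ hpos heq x y
  have : Nonempty {α : Type // Countable α ∧ Nonempty α} :=
    ⟨Unit, inferInstance, inferInstance⟩
  obtain ⟨Ω, rfl⟩ : ∃ Ω : V → {α : Type // Countable α ∧ Nonempty α},
      (fun v : S => (Ω v).1) = Ω' :=
    (Subtype.exists_pi_extension (fun v : S => ⟨Ω' v, inferInstance, inferInstance⟩)).imp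
      fun Ω hΩ => funext fun v => congrArg Subtype.val (congrFun hΩ v)
  have hcountable : ∀ v, Countable (Ω v).1 := fun v => (Ω v).2.1
  have hnonempty : ∀ v, Nonempty (Ω v).1 := fun v => (Ω v).2.2
  obtain ⟨x, rfl⟩ := Subtype.exists_pi_extension (α := fun v => (Ω v).1) x
  obtain ⟨y, rfl⟩ := Subtype.exists_pi_extension (α := fun v => (Ω v).1) y
  obtain ⟨c, hc, hext⟩ := exists_extension (fun v => (Ω v).1) G S
  obtain ⟨N₁, hN₁, hobs₁, heff₁⟩ := hext M₁ h₁
  obtain ⟨N₂, hN₂, hobs₂, heff₂⟩ := hext M₂ h₂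
  rw [← heff₁ X Y hY, ← heff₂ X Y hY]
  refine hG _ N₁ N₂ hN₁ hN₂ (fun v => ?_) (fun v => ?_) x y
  · rw [hobs₁]
    exact ENNReal.mul_pos (hpos _).ne' (hc v)
  · rw [hobs₁, hobs₂, heq]

theorem effect_eq_of_induce_compl
    (hG : Identifiable (G.induce Zᶜ) (Subtype.val ⁻¹' X) (Subtype.val ⁻¹' Y))
    (hZ : Disjoint Z (X ∪ Y)) (hW : G.ConnectedOnlyThrough Z W) {Ω : V → Type}
    [∀ v, Countable (Ω v)] [∀ v, Nonempty (Ω v)] {M : SemiMarkovianModel Ω}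
    {M' : SemiMarkovianModel (fun v : ↥Zᶜ => Ω v)} (hM : M.graph = G)
    (hM' : M'.graph = G.induce Zᶜ) (hpos : ∀ v, 0 < M.obs univ v)
    (hobs : ∀ v : (∀ i, Ω i), M'.obs univ (fun i => v i) = M.obs Zᶜ v) (x y : ∀ v, Ω v) :
    M.effect X x Y y =
      M'.effect (Subtype.val ⁻¹' X) (fun i => x i) (Subtype.val ⁻¹' Y) (fun i => y i) := by
  obtain ⟨N, hN, hNobs, hNeff⟩ := exists_projection hZ hW M hM
  rw [hNeff]
  refine hG _ N M' hN hM' (fun w => ?_) (fun w => ?_) _ _ <;>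
    obtain ⟨v, rfl⟩ := Subtype.exists_pi_extension w
  · rw [hNobs]
    exact (hpos v).trans_le (M.obs_univ_le _ v)
  · rw [hNobs, hobs]

theorem of_induce_compl
    (hG : Identifiable (G.induce Zᶜ) (Subtype.val ⁻¹' X) (Subtype.val ⁻¹' Y))
    (hZ : Disjoint Z (X ∪ Y)) (hW : G.ConnectedOnlyThrough Z W) : Identifiable G X Y := by
  intro Ω _ _ M₁ M₂ h₁ h₂ hpos heq x y
  obtain ⟨N, hN, hNobs, hNeff⟩ := exists_projection hZ hW M₂ h₂
  have hobs : ∀ v : (∀ i, Ω i), N.obs univ (fun i => v i) = M₁.obs Zᶜ v := fun v =>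
    (hNobs v).trans (obs_congr heq Zᶜ v).symm
  rw [hNeff, hG.effect_eq_of_induce_compl hZ hW h₁ hN hpos hobs]

end Identifiable

theorem mainTheorem4_general {V : Type u} [Finite V] (G : SMG V) (X Y Z : Set V) (W : V)
    (hZ : Disjoint Z (X ∪ Y)) (hW : G.ConnectedOnlyThrough Z W) :
    (∀ (Ω : V → Type) [∀ v, Countable (Ω v)] [∀ v, Nonempty (Ω v)] (M : SemiMarkovianModel Ω),
      M.graph = G →
      ∃ M' : SemiMarkovianModel (fun v : ↥Zᶜ => Ω v),
        M'.graph = G.induce Zᶜ ∧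
        (∀ v : (∀ i, Ω i), M'.obs univ (fun i => v i) = M.obs Zᶜ v) ∧
        ∀ x y : (∀ i, Ω i),
          M.effect X x Y y =
            M'.effect (Subtype.val ⁻¹' X) (fun i => x i) (Subtype.val ⁻¹' Y) (fun i => y i)) ∧
    (Identifiable G X Y ↔
      Identifiable (G.induce Zᶜ) (Subtype.val ⁻¹' X) (Subtype.val ⁻¹' Y)) ∧
    (Identifiable G X Y →
      ∀ (Ω : V → Type) [∀ v, Countable (Ω v)] [∀ v, Nonempty (Ω v)]
        (M : SemiMarkovianModel Ω) (M' : SemiMarkovianModel (fun v : ↥Zᶜ => Ω v)),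
        M.graph = G → M'.graph = G.induce Zᶜ →
        (∀ v, 0 < M.obs univ v) →
        (∀ v : (∀ i, Ω i), M'.obs univ (fun i => v i) = M.obs Zᶜ v) →
        ∀ x y : (∀ i, Ω i),
          M.effect X x Y y =
            M'.effect (Subtype.val ⁻¹' X) (fun i => x i) (Subtype.val ⁻¹' Y)
              (fun i => y i)) := by
  have hY : Y ⊆ Zᶜ := subset_compl_iff_disjoint_left.mpr (disjoint_union_right.mp hZ).2
  exact ⟨fun Ω _ _ => exists_projection hZ hW, ⟨.induce hY, fun hG => hG.of_induce_compl hZ hW⟩,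
    fun hG Ω _ _ M M' => (hG.induce hY).effect_eq_of_induce_compl hZ hW⟩

theorem mainTheorem4 {V : Type u} [Finite V] (G : SMG V) (X Y Z : Set V) (W : V)
    (hXY : Disjoint X Y) (hAn : G.An Y = univ) (hZ : Disjoint Z (X ∪ Y))
    (hW : G.ConnectedOnlyThrough Z W) :
    -- every model inducing `G` has a counterpart inducing `G[V \ Z]`, with the observational
    -- distribution `P(V \ Z)` and the same causal effect of `X` on `Y`
    (∀ (Ω : V → Type) [∀ v, Countable (Ω v)] [∀ v, Nonempty (Ω v)] (M : SemiMarkovianModel Ω),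
      M.graph = G →
      ∃ M' : SemiMarkovianModel (fun v : ↥Zᶜ => Ω v),
        M'.graph = G.induce Zᶜ ∧
        (∀ v : (∀ i, Ω i), M'.obs univ (fun i => v i) = M.obs Zᶜ v) ∧
        ∀ x y : (∀ i, Ω i),
          M.effect X x Y y =
            M'.effect (Subtype.val ⁻¹' X) (fun i => x i) (Subtype.val ⁻¹' Y) (fun i => y i)) ∧
    -- the effect is identifiable from `P` in `G` iff it is so from `P(V \ Z)` in `G[V \ Z]`
    (Identifiable G X Y ↔
      Identifiable (G.induce Zᶜ) (Subtype.val ⁻¹' X) (Subtype.val ⁻¹' Y)) ∧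
    -- and then the value determined by `P` in `G` is the one determined by `P(V \ Z)`
    -- in `G[V \ Z]`
    (Identifiable G X Y →
      ∀ (Ω : V → Type) [∀ v, Countable (Ω v)] [∀ v, Nonempty (Ω v)]
        (M : SemiMarkovianModel Ω) (M' : SemiMarkovianModel (fun v : ↥Zᶜ => Ω v)),
        M.graph = G → M'.graph = G.induce Zᶜ →
        (∀ v, 0 < M.obs univ v) →
        (∀ v : (∀ i, Ω i), M'.obs univ (fun i => v i) = M.obs Zᶜ v) →
        ∀ x y : (∀ i, Ω i),
          M.effect X x Y y =
            M'.effect (Subtype.val ⁻¹' X) (fun i => x i) (Subtype.val ⁻¹' Y)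
              (fun i => y i)) :=
  mainTheorem4_general G X Y Z W hZ hW
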